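/- Let $G$ be a compact Hausdorff group acting continuously on a compact Hausdorff space $X$. For $x\in X$ write $G_x=\{s\in G : s\cdot x=x\}$ for the isotropy group of $x$, and let $X_{(1)}=\{x\in X : G_x=\{1\}\}$. Let $G$ act on the algebra $C(X)$ of complex-valued continuous functions by $(s\triangleright f)(x)=f(s^{-1}x)$, and let $C(X)^G$ be the subalgebra of invariant functions. Let $\alpha$ be an irreducible (continuous, complex, finite-dimensional) representation of $G$, and let $C(X)_\alpha$ be its isotypic component: the set of $f\in C(X)$ such that the linear span of the orbit $\{s\triangleright f : s\in G\}$ is isomorphic, as a representation of $G$, to $\alpha^n$ for some integer $n\ge 0$; it is a $C(X)^G$-submodule of $C(X)$. Call $\alpha$ tame if $C(X)_\alpha$ is finitely generated as a $C(X)^G$-module. Let $x$ lie in the closure $\overline{X_{(1)}}$ of $X_{(1)}$. If the restriction of $\alpha$ to $G_x$ is non-trivial, i.e. some element of $G_x$ does not act as the identity under $\alpha$, then $\alpha$ is not tame. -/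

import Mathlib

open scoped MonoidAlgebra

namespace CompactAction

/-- A vector generates a finite power of the simple module `S` if and only if it lies in the sum of
all submodules isomorphic to `S`. -/
theorem exists_span_equiv_iff {R M S : Type*} [Ring R] [AddCommGroup M] [Module R M]
    [AddCommGroup S] [Module R S] [IsSimpleModule R S] (v : M) :
    (∃ n : ℕ, Nonempty (Submodule.span R {v} ≃ₗ[R] (Fin n → S))) ↔
      v ∈ isotypicComponent R M S := by
  constructor
  · rintro ⟨n, ⟨e⟩⟩
    let w : Fin n → S := e ⟨v, Submodule.mem_span_singleton_self v⟩
    let F : (Fin n → S) →ₗ[R] M := (Submodule.span R {v}).subtype ∘ₗ e.symm.toLinearMap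
    have hF : F w = v := by simp [F, w]
    have hw : w = ∑ i, Pi.single i (w i) := (Finset.univ_sum_single w).symm
    rw [← hF, hw, map_sum]
    refine sum_mem fun i _ => ?_
    have h1 := LinearMap.le_comap_isotypicComponent S
      (F ∘ₗ LinearMap.single R (fun _ : Fin n => S) i)
    have h2 : isotypicComponent R S S = ⊤ := top_unique (le_sSup ⟨Submodule.topEquiv⟩)
    rw [h2] at h1
    exact h1 (Submodule.mem_top (x := w i))
  · intro h
    have hle : Submodule.span R {v} ≤ isotypicComponent R M S := by
      rwa [Submodule.span_singleton_le_iff_mem]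
    have : IsSemisimpleModule R (Submodule.span R {v}) :=
      IsSemisimpleModule.of_injective (Submodule.inclusion hle) (Submodule.inclusion_injective hle)
    have hT : IsIsotypicOfType R (Submodule.span R {v}) S :=
      (IsIsotypicOfType.isotypicComponent R M S).of_injective (Submodule.inclusion hle)
        (Submodule.inclusion_injective hle)
    exact hT.linearEquiv_fun

noncomputable section

variable (G X : Type*) [Group G] [TopologicalSpace X] [MulAction G X] [ContinuousConstSMul G X]

/-- The translation action `(s ▷ f)(x) = f (s⁻¹ • x)` of `G` on the algebra `C(X, ℂ)` of
complex-valued continuous functions on the `G`-space `X`. -/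
def translation : Representation ℂ G C(X, ℂ) where
  toFun s :=
    { toFun := fun f => ⟨fun x => f (s⁻¹ • x), f.continuous.comp (continuous_const_smul s⁻¹)⟩
      map_add' := fun _ _ => rfl
      map_smul' := fun _ _ => rfl }
  map_one' := by
    ext f x
    simp
  map_mul' s t := by
    ext f x
    simp [mul_smul]

@[simp]
theorem translation_apply (s : G) (f : C(X, ℂ)) (x : X) :
    translation G X s f x = f (s⁻¹ • x) := rfl

/-- The subalgebra of `C(X, ℂ)` consisting of the `G`-invariant functions. -/
def invariantSubalgebra : Subalgebra ℂ C(X, ℂ) where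
  carrier := {a | ∀ s : G, translation G X s a = a}
  mul_mem' := by
    intro a b ha hb s
    ext x
    have h1 := DFunLike.congr_fun (ha s) x
    have h2 := DFunLike.congr_fun (hb s) x
    simp only [translation_apply] at h1 h2
    simp [h1, h2]
  add_mem' := by
    intro a b ha hb s
    rw [map_add, ha s, hb s]
  algebraMap_mem' := by
    intro r s
    ext x
    rfl

end

noncomputable section

variable {G : Type*} (X : Type*) [Group G] [TopologicalSpace X] [MulAction G X]
  [ContinuousConstSMul G X] {V : Type*} [AddCommGroup V] [Module ℂ V]

/-- `f` is isotypic of type `α` if the linear span of its `G`-orbit is isomorphic, as a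
representation of `G`, to a finite power `αⁿ`. (Representations are regarded as modules over the
group algebra, so that the span of the orbit is the submodule generated by `f`. The value `n = 0`
only occurs for `f = 0`.) -/
def IsIsotypicFunction (α : Representation ℂ G V) (f : C(X, ℂ)) : Prop :=
  ∃ n : ℕ, Nonempty
    (Submodule.span ℂ[G] {(translation G X).asModuleEquiv.symm f} ≃ₗ[ℂ[G]] (Fin n → α.asModule))

theorem isIsotypicFunction_iff (α : Representation ℂ G V) [α.IsIrreducible] (f : C(X, ℂ)) :
    IsIsotypicFunction X α f ↔ (translation G X).asModuleEquiv.symm f ∈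
      isotypicComponent ℂ[G] (translation G X).asModule α.asModule :=
  exists_span_equiv_iff (R := ℂ[G]) (M := (translation G X).asModule) (S := α.asModule) _

/-- The isotypic component `C(X)_α`, a module over the algebra of invariant functions. -/
def isotypicPart (α : Representation ℂ G V) [α.IsIrreducible] :
    Submodule (invariantSubalgebra G X) C(X, ℂ) where
  carrier := {f | IsIsotypicFunction X α f}
  zero_mem' := by
    rw [Set.mem_ofPred_eq, isIsotypicFunction_iff, map_zero]
    exact zero_mem _
  add_mem' := by
    intro f g hf hg
    rw [Set.mem_ofPred_eq, isIsotypicFunction_iff] at *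
    rw [map_add]
    exact add_mem hf hg
  smul_mem' := by
    intro a f hf
    rw [Set.mem_ofPred_eq, isIsotypicFunction_iff] at *
    let M : (translation G X).IntertwiningMap (translation G X) :=
      { toLinearMap := LinearMap.mulLeft ℂ (a : C(X, ℂ))
        isIntertwining' := by
          intro s
          ext g x
          have h := DFunLike.congr_fun (a.2 s) x
          simp only [translation_apply] at h
          simp [h] }
    exact LinearMap.le_comap_isotypicComponent (R := ℂ[G]) (M := (translation G X).asModule)
      (N := (translation G X).asModule) α.asModule (Representation.IntertwiningMap.equivLinearMapAsModule _ _ M) hf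

/-- `α` is tame if `C(X)_α` is finitely generated over the algebra of invariant functions. -/
def IsTame (α : Representation ℂ G V) [α.IsIrreducible] : Prop :=
  Module.Finite (invariantSubalgebra G X) (isotypicPart X α)

end

end CompactAction

open MeasureTheory Topology

namespace CompactAction

section Generators

variable {G X : Type*} [Group G] [TopologicalSpace X] [MulAction G X] [ContinuousConstSMul G X]
  {V : Type*} [AddCommGroup V] [Module ℂ V] {α : Representation ℂ G V} [α.IsIrreducible]

/-! Pairing an equivariant map `F : X → V*` with a vector `v` gives an element of `C(X)_α`. If the
`m i` generate, then `F(·) v = ∑ a i * m i` with invariant `a i`, and the open mapping theorem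
bounds the `a i` by a multiple of `‖F‖` (`exists_bounded_coefficients`). Choose `g ∈ G_x`, `v` and a
functional `l` with `l (α g v - v) = 1`. At a free point `y` some equivariant `F` has `F y = l`,
with a norm bound independent of `y` (`exists_equivariant_extension`). Equivariance then gives `1 =
∑ a i y * (m i (g⁻¹ y) - m i y)`, so `1 ≤ K * ∑ ‖m i (g⁻¹ y) - m i y‖` with `K` uniform in `y`. This
passes to the closure, but at `x` the sum vanishes. -/

theorem IsTame.exists_generators (h : IsTame X α) :
    ∃ (n : ℕ) (m : Fin n → C(X, ℂ)), (∀ f, IsIsotypicFunction X α f →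
      ∃ a : Fin n → C(X, ℂ), (∀ i (s : G) z, a i (s⁻¹ • z) = a i z) ∧
        ∀ z, ∑ i, a i z * m i z = f z) := by
  have h' : Module.Finite (invariantSubalgebra G X) (isotypicPart X α) := h
  obtain ⟨n, m, hm⟩ := h'.exists_fin
  refine ⟨n, fun i => m i, fun f hf => ?_⟩
  have hmem : (⟨f, hf⟩ : isotypicPart X α) ∈
      Submodule.span (invariantSubalgebra G X) (Set.range m) := hm ▸ Submodule.mem_top
  obtain ⟨a, ha⟩ := (Submodule.mem_span_range_iff_exists_fun _).1 hmem
  refine ⟨fun i => a i, fun i s => DFunLike.congr_fun ((a i).2 s), ?_⟩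
  have hsum := congrArg (isotypicPart X α).subtype ha
  rw [map_sum] at hsum
  intro z
  have hz := DFunLike.congr_fun hsum z
  rw [ContinuousMap.sum_apply] at hz
  exact hz

end Generators

/-! ### Uniform bounds from the open mapping theorem. -/

/-- If a closed linear relation between Banach spaces has closed range, then every element of the
range has related elements of controlled norm. -/
theorem exists_bounded_related {E F : Type*} [NormedAddCommGroup E] [NormedSpace ℂ E]
    [CompleteSpace E] [NormedAddCommGroup F] [NormedSpace ℂ F] [CompleteSpace F]
    (R : E → F → Prop) (h0 : R 0 0)
    (hadd : ∀ a b w w', R a w → R b w' → R (a + b) (w + w'))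
    (hsmul : ∀ (c : ℂ) a w, R a w → R (c • a) (c • w))
    (hR : IsClosed {p : E × F | R p.1 p.2}) (hP : IsClosed {w | ∃ a, R a w}) :
    ∃ C : ℝ, ∀ w a, R a w → ∃ b, R b w ∧ ‖b‖ ≤ C * ‖w‖ := by
  let D : Submodule ℂ (E × F) :=
    { carrier := {p | R p.1 p.2}
      zero_mem' := h0
      add_mem' := hadd _ _ _ _
      smul_mem' := fun c _ => hsmul c _ _ }
  let P : Submodule ℂ F :=
    { carrier := {w | ∃ a, R a w}
      zero_mem' := ⟨0, h0⟩
      add_mem' := fun ⟨a, ha⟩ ⟨b, hb⟩ => ⟨a + b, hadd _ _ _ _ ha hb⟩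
      smul_mem' := fun c _ ⟨a, ha⟩ => ⟨c • a, hsmul c _ _ ha⟩ }
  have : CompleteSpace D := hR.completeSpace_coe
  have : CompleteSpace P := hP.completeSpace_coe
  let π : D →L[ℂ] P :=
    ((ContinuousLinearMap.snd ℂ E F).comp D.subtypeL).codRestrict P fun p => ⟨_, p.2⟩
  have hπ : Function.Surjective π := by
    rintro ⟨w, a, ha⟩
    exact ⟨⟨(a, w), ha⟩, rfl⟩
  -- Open mapping theorem for the projection of the graph onto the range.
  obtain ⟨C, -, hC⟩ := π.exists_preimage_norm_le hπ
  refine ⟨C, fun w a ha => ?_⟩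
  obtain ⟨⟨⟨b, w'⟩, h⟩, hp, hle⟩ := hC ⟨w, a, ha⟩
  obtain rfl : w' = w := congrArg Subtype.val hp
  exact ⟨b, h, (le_max_left _ _).trans hle⟩

/-- If the functions `e ∘ F`, for `F` in a closed space of maps, are combinations of finitely many
functions with invariant coefficients, then the coefficients can be chosen with bounded norms. -/
theorem exists_bounded_coefficients {G X W : Type*} [Group G] [TopologicalSpace X] [CompactSpace X]
    [MulAction G X] [NormedAddCommGroup W] [NormedSpace ℂ W] [CompleteSpace W]
    (P : Submodule ℂ C(X, W)) (hP : IsClosed (P : Set C(X, W))) (e : W →L[ℂ] ℂ)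
    {n : ℕ} (f : Fin n → C(X, ℂ))
    (hf : ∀ F ∈ P, ∃ a : Fin n → C(X, ℂ),
      (∀ i (s : G) z, a i (s⁻¹ • z) = a i z) ∧ ∀ z, ∑ i, a i z * f i z = e (F z)) :
    ∃ C : ℝ, ∀ F ∈ P, ∃ a : Fin n → C(X, ℂ),
      (∀ i (s : G) z, a i (s⁻¹ • z) = a i z) ∧ (∀ z, ∑ i, a i z * f i z = e (F z)) ∧
        ∀ i z, ‖a i z‖ ≤ C * ‖F‖ := by
  -- A relation rather than a map, since coefficients need not be unique; requiring `F ∈ P` makes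
  -- its range exactly the closed space `P`.
  let R : (Fin n → C(X, ℂ)) → C(X, W) → Prop := fun a F =>
    (∀ i (s : G) z, a i (s⁻¹ • z) = a i z) ∧ F ∈ P ∧
      ∀ z, ∑ i, a i z * f i z = e (F z)
  have hrange : {F | ∃ a, R a F} = (P : Set C(X, W)) := by
    ext F
    exact ⟨fun ⟨a, ha⟩ => ha.2.1, fun hF => (hf F hF).imp fun a ha => ⟨ha.1, hF, ha.2⟩⟩
  have hclosed : IsClosed {p : (Fin n → C(X, ℂ)) × C(X, W) | R p.1 p.2} := by
    have h : {p : (Fin n → C(X, ℂ)) × C(X, W) | R p.1 p.2} =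
        (⋂ (i) (s : G) (z),
            {p : (Fin n → C(X, ℂ)) × C(X, W) | p.1 i (s⁻¹ • z) = p.1 i z}) ∩
          (Prod.snd ⁻¹' (P : Set C(X, W)) ∩
            ⋂ z, {p | ∑ i, p.1 i z * f i z = e (p.2 z)}) := by
      ext p
      simp only [Set.mem_inter_iff, Set.mem_iInter]
      rfl
    rw [h]
    exact (isClosed_iInter fun i => isClosed_iInter fun s => isClosed_iInter fun z =>
      isClosed_eq (by fun_prop) (by fun_prop)).inter
      ((hP.preimage continuous_snd).inter
        (isClosed_iInter fun z => isClosed_eq (by fun_prop) (by fun_prop)))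
  have hzero : R 0 0 := ⟨fun _ _ _ => rfl, P.zero_mem, fun z => by simp⟩
  have hadd : ∀ a b F F', R a F → R b F' → R (a + b) (F + F') :=
    fun a b F F' ⟨h1, h2, h3⟩ ⟨k1, k2, k3⟩ =>
      ⟨fun i s z => by simp [h1, k1], P.add_mem h2 k2,
        fun z => by simp [add_mul, Finset.sum_add_distrib, h3, k3]⟩
  have hsmul : ∀ (c : ℂ) a F, R a F → R (c • a) (c • F) :=
    fun c a F ⟨h1, h2, h3⟩ =>
      ⟨fun i s z => by simp [h1], P.smul_mem c h2,
        fun z => by simp [mul_assoc, ← Finset.mul_sum, h3]⟩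
  have hrangeC : IsClosed {F | ∃ a, R a F} := hrange ▸ hP
  obtain ⟨C, hC⟩ := exists_bounded_related R hzero hadd hsmul hclosed hrangeC
  refine ⟨C, fun F hF => ?_⟩
  obtain ⟨a, ha⟩ := hf F hF
  obtain ⟨b, ⟨h1, -, h3⟩, hle⟩ := hC F a ⟨ha.1, hF, ha.2⟩
  exact ⟨b, h1, h3, fun i z =>
    (((b i).norm_coe_le_norm z).trans (norm_le_pi_norm b i)).trans hle⟩

/-! ### Equivariant maps into the dual representation. -/

section Equivariant

variable {G : Type*} [Group G] {X : Type*} [TopologicalSpace X] [MulAction G X]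
  {V : Type*} [NormedAddCommGroup V] [NormedSpace ℂ V]

/-- The space of `G`-equivariant continuous maps from `X` to the dual of a representation. -/
def equivariantMaps [CompactSpace X] (α : Representation ℂ G V) :
    Submodule ℂ C(X, V →L[ℂ] ℂ) where
  carrier := {F | ∀ (s : G) (z : X) (w : V), F (s • z) (α s w) = F z w}
  zero_mem' _ _ _ := rfl
  add_mem' hF hF' s z w := by simp [hF s z w, hF' s z w]
  smul_mem' c F hF s z w := by simp [hF s z w]

variable [CompactSpace X] (α : Representation ℂ G V)

theorem isClosed_equivariantMaps :
    IsClosed (equivariantMaps (X := X) α : Set C(X, V →L[ℂ] ℂ)) := by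
  have h : (equivariantMaps (X := X) α : Set C(X, V →L[ℂ] ℂ)) =
      ⋂ (s : G) (z : X) (w : V), {F | F (s • z) (α s w) = F z w} := by
    ext F
    simp only [Set.mem_iInter]
    rfl
  rw [h]
  exact isClosed_iInter fun s => isClosed_iInter fun z => isClosed_iInter fun w =>
    isClosed_eq (by fun_prop) (by fun_prop)

variable (X) in
/-- Pairing a map into the dual of `V` with a fixed vector. -/
noncomputable def pairing (v : V) : C(X, V →L[ℂ] ℂ) →L[ℂ] C(X, ℂ) :=
  (ContinuousLinearMap.apply ℂ ℂ v).compLeftContinuous ℂ X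

omit [CompactSpace X] in
@[simp]
theorem pairing_apply (v : V) (F : C(X, V →L[ℂ] ℂ)) (z : X) : pairing X v F z = F z v := rfl

variable {α} [ContinuousConstSMul G X]

theorem translation_pairing {F : C(X, V →L[ℂ] ℂ)} (hF : F ∈ equivariantMaps α) (s : G) (v : V) :
    translation G X s (pairing X v F) = pairing X (α s v) F := by
  ext z
  have h := hF s (s⁻¹ • z) v
  rw [smul_inv_smul] at h
  simpa using h.symm

/-- For fixed `F`, pairing is an intertwiner from `α` to the translation action, and intertwiners
preserve isotypic components. -/
theorem isIsotypicFunction_pairing [α.IsIrreducible] {F : C(X, V →L[ℂ] ℂ)}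
    (hF : F ∈ equivariantMaps α) (v : V) : IsIsotypicFunction X α (pairing X v F) := by
  rw [isIsotypicFunction_iff]
  let T : α.IntertwiningMap (translation G X) :=
    { toFun := fun w => pairing X w F
      map_add' := fun w w' => by ext z; simp
      map_smul' := fun c w => by ext z; simp
      isIntertwining' := fun s => by
        ext w : 1
        exact (translation_pairing hF s w).symm }
  have h1 := LinearMap.le_comap_isotypicComponent (R := ℂ[G]) α.asModule
    (Representation.IntertwiningMap.equivLinearMapAsModule _ _ T)
  have h2 : isotypicComponent ℂ[G] α.asModule α.asModule = ⊤ :=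
    top_unique (le_sSup ⟨Submodule.topEquiv⟩)
  rw [h2] at h1
  exact h1 (Submodule.mem_top (x := α.asModuleEquiv.symm v))

end Equivariant

/-! ### Extension from free orbits and averaging. -/

section Extension

variable {G : Type*} [Group G] [TopologicalSpace G] [IsTopologicalGroup G] [CompactSpace G]
  {X : Type*} [TopologicalSpace X] [CompactSpace X] [T2Space X]
  [MulAction G X] [ContinuousSMul G X]
  {V : Type*} [NormedAddCommGroup V] [NormedSpace ℂ V] [FiniteDimensional ℂ V]
  {α : Representation ℂ G V}

variable (α) in
/-- The operators of a finite-dimensional representation as continuous linear maps. -/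
noncomputable def operator (s : G) : V →L[ℂ] V := LinearMap.toContinuousLinearMap (α s)

omit [TopologicalSpace G] [IsTopologicalGroup G] [CompactSpace G] in
@[simp]
theorem operator_apply (s : G) (v : V) : operator α s v = α s v := rfl

omit [IsTopologicalGroup G] [CompactSpace G] in
theorem continuous_operator (hα : ∀ v : V, Continuous fun s : G => α s v) :
    Continuous (operator α) :=
  continuous_clm_apply.2 hα

omit [IsTopologicalGroup G] in
theorem exists_norm_operator_le (hα : ∀ v : V, Continuous fun s : G => α s v) :
    ∃ B : ℝ, 0 < B ∧ ∀ s : G, ‖operator α s‖ ≤ B := by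
  obtain ⟨B, hB⟩ := isCompact_univ.exists_bound_of_continuousOn
    (continuous_operator hα).continuousOn
  -- The maximum with `1` makes the bound positive, as the radius in the Tietze extension requires.
  exact ⟨max B 1, by positivity, fun s => (hB s trivial).trans (le_max_left _ _)⟩

omit [T2Space X] in
/-- Averaging a map into the dual of `V` over the group makes it equivariant, without changing
its value at a point on whose orbit it is equivariant already. -/
theorem exists_average (hα : ∀ v : V, Continuous fun s : G => α s v) {B : ℝ}
    (hB : ∀ s : G, ‖operator α s‖ ≤ B) (F : C(X, V →L[ℂ] ℂ)) {K : ℝ} (hK : ∀ z, ‖F z‖ ≤ K)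
    (y : X) (hy : ∀ s : G, F (s • y) = (F y).comp (operator α s⁻¹)) :
    ∃ F' ∈ equivariantMaps (X := X) α, F' y = F y ∧ ‖F'‖ ≤ K * B := by
  let _ : MeasurableSpace G := borel G
  have : BorelSpace G := ⟨rfl⟩
  let μ : Measure G := Measure.haarMeasure ⊤
  have hμ1 : μ Set.univ = 1 := Measure.haarMeasure_self (K₀ := (⊤ : TopologicalSpace.PositiveCompacts G))
  have : IsProbabilityMeasure μ := ⟨hμ1⟩
  have hop := continuous_operator hα
  let φ : X → G → (V →L[ℂ] ℂ) := fun z s => (F (s⁻¹ • z)).comp (operator α s⁻¹)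
  have hφ : Continuous φ.uncurry := by
    refine Continuous.clm_comp ?_ ?_ <;> fun_prop
  have hint : ∀ z, Integrable (φ z) μ := fun z =>
    (hφ.comp (Continuous.prodMk_right z)).integrable_of_hasCompactSupport
      (HasCompactSupport.of_compactSpace _)
  have hcont : Continuous fun z => ∫ s, φ z s ∂μ := by
    rw [← continuousOn_univ]
    exact continuousOn_integral_of_compact_support isCompact_univ hφ.continuousOn
      fun p s _ hs => absurd trivial hs
  have hK0 : 0 ≤ K := (norm_nonneg _).trans (hK y)
  have hB0 : 0 ≤ B := (norm_nonneg _).trans (hB 1)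
  refine ⟨⟨_, hcont⟩, fun t z w => ?_, ?_, ?_⟩
  · simp only [ContinuousMap.coe_mk]
    rw [ContinuousLinearMap.integral_apply (hint _), ContinuousLinearMap.integral_apply (hint _),
      -- Left invariance of Haar measure: substitute `t * s` for `s`.
      ← integral_mul_left_eq_self _ t]
    refine integral_congr_ae (.of_forall fun s => ?_)
    simp [φ, mul_smul]
  -- At `y` the integrand is constant and the measure has mass `1`.
  · have h : ∀ s, φ y s = F y := fun s => by
      ext w
      simp [φ, hy]
    simp [h]
  · refine (ContinuousMap.norm_le _ (by positivity)).2 fun z => ?_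
    have h : ∀ s, ‖φ z s‖ ≤ K * B := fun s =>
      (ContinuousLinearMap.opNorm_comp_le _ _).trans
        (mul_le_mul (hK _) (hB _) (norm_nonneg _) hK0)
    simpa using norm_integral_le_of_norm_le_const (μ := μ) (.of_forall h)

/-- Over a free orbit every functional is a value of an equivariant map of controlled norm. -/
theorem exists_equivariant_extension (hα : ∀ v : V, Continuous fun s : G => α s v) {B : ℝ}
    (hB0 : 0 < B) (hB : ∀ s : G, ‖operator α s‖ ≤ B) {y : X} (hy : MulAction.stabilizer G y = ⊥)
    {l : V →L[ℂ] ℂ} (hl : l ≠ 0) :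
    ∃ F ∈ equivariantMaps (X := X) α, F y = l ∧ ‖F‖ ≤ ‖l‖ * B * B := by
  have hinj : Function.Injective fun s : G => s • y := fun s t hst => by
    have h : t⁻¹ * s ∈ MulAction.stabilizer G y := by
      simpa [MulAction.mem_stabilizer_iff, mul_smul, inv_smul_eq_iff] using hst
    rw [hy, Subgroup.mem_bot, inv_mul_eq_one] at h
    exact h.symm
  have hemb : IsClosedEmbedding fun s : G => s • y :=
    Continuous.isClosedEmbedding (by fun_prop) hinj
  have hop := continuous_operator hα
  -- These are the values on the orbit forced by equivariance and `F y = l`. Tietze extension into a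
  -- closed ball keeps the bound `‖l‖ * B`; averaging costs the second factor `B`.
  let f : C(G, V →L[ℂ] ℂ) := ⟨fun s => l.comp (operator α s⁻¹), by fun_prop⟩
  have hf : ∀ s, f s ∈ Metric.closedBall (0 : V →L[ℂ] ℂ) (‖l‖ * B) := fun s => by
    rw [mem_closedBall_zero_iff]
    exact (ContinuousLinearMap.opNorm_comp_le _ _).trans (by gcongr; exact hB _)
  have := Metric.instTietzeExtensionClosedBall ℂ (0 : V →L[ℂ] ℂ)
    (r := ‖l‖ * B) (mul_pos (norm_pos_iff.2 hl) hB0)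
  obtain ⟨F, hF, hFf⟩ := f.exists_extension_forall_mem hemb hf
  have hFs : ∀ s : G, F (s • y) = l.comp (operator α s⁻¹) := fun s => DFunLike.congr_fun hFf s
  have hFy : F y = l := by
    have h := hFs 1
    ext w
    rw [one_smul] at h
    simp [h]
  obtain ⟨F', hF', hval, hnorm⟩ := exists_average hα hB F
    (fun z => mem_closedBall_zero_iff.1 (hF z)) y (fun s => by rw [hFs, hFy])
  exact ⟨F', hF', hval.trans hFy, hnorm⟩

/-- If the functions `m i` generate `C(X)_α`, then at free points their increments along `g⁻¹` are
bounded below as soon as `α g` is not the identity. -/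
theorem exists_one_le_mul_sum_increments [α.IsIrreducible]
    (hα : ∀ v : V, Continuous fun s : G => α s v) {n : ℕ} (m : Fin n → C(X, ℂ))
    (hm : ∀ f, IsIsotypicFunction X α f →
      ∃ a : Fin n → C(X, ℂ), (∀ i (s : G) z, a i (s⁻¹ • z) = a i z) ∧
        ∀ z, ∑ i, a i z * m i z = f z)
    (g : G) {v : V} (hu : α g v ≠ v) :
    ∃ K : ℝ, ∀ y : X, MulAction.stabilizer G y = ⊥ →
      1 ≤ K * ∑ i, ‖m i (g⁻¹ • y) - m i y‖ := by
  obtain ⟨C, hC⟩ := exists_bounded_coefficients (equivariantMaps (X := X) α)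
    (isClosed_equivariantMaps α) (ContinuousLinearMap.apply ℂ ℂ v) m
    fun F hF => hm _ (isIsotypicFunction_pairing hF v)
  obtain ⟨B, hB0, hB⟩ := exists_norm_operator_le hα
  obtain ⟨l, hl⟩ := SeparatingDual.exists_eq_one (R := ℂ) (sub_ne_zero.2 hu)
  have hl0 : l ≠ 0 := by
    rintro rfl
    simp at hl
  refine ⟨|C| * (‖l‖ * B * B), fun y hy => ?_⟩
  obtain ⟨F, hF, hFy, hFn⟩ := exists_equivariant_extension hα hB0 hB hy hl0
  obtain ⟨a, hinv, hsum, han⟩ := hC F hF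
  have hval : ∀ z, ∑ i, a i z * m i z = F z v := hsum
  have hFg : F y (α g v) = F (g⁻¹ • y) v := by
    simpa using hF g (g⁻¹ • y) v
  have hbound : ∀ i, ‖a i y‖ ≤ |C| * (‖l‖ * B * B) := fun i =>
    (han i y).trans (mul_le_mul (le_abs_self C) hFn (norm_nonneg F) (abs_nonneg C))
  -- Invariance of `a i` lets the same coefficient serve at `y` and at `g⁻¹ • y`.
  have hone : ∑ i, a i y * (m i (g⁻¹ • y) - m i y) = 1 := by
    rw [← hl, map_sub, ← hFy, hFg, ← hval, ← hval, ← Finset.sum_sub_distrib]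
    simp only [hinv, mul_sub]
  calc (1 : ℝ) = ‖∑ i, a i y * (m i (g⁻¹ • y) - m i y)‖ := by
        rw [hone, norm_one]
    _ ≤ ∑ i, |C| * (‖l‖ * B * B) * ‖m i (g⁻¹ • y) - m i y‖ :=
        norm_sum_le_of_le _ fun i _ => by
          rw [norm_mul]
          exact mul_le_mul_of_nonneg_right (hbound i) (norm_nonneg _)
    _ = _ := (Finset.mul_sum _ _ _).symm

end Extension

end CompactAction

theorem mainTheorem3
    {G : Type*} [Group G] [TopologicalSpace G] [IsTopologicalGroup G] [CompactSpace G] [T2Space G]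
    {X : Type*} [TopologicalSpace X] [CompactSpace X] [T2Space X]
    [MulAction G X] [ContinuousSMul G X]
    {V : Type*} [NormedAddCommGroup V] [NormedSpace ℂ V] [FiniteDimensional ℂ V]
    (α : Representation ℂ G V) [α.IsIrreducible] (hα : ∀ v : V, Continuous fun s : G => α s v)
    (x : X) (hx : x ∈ closure {y : X | MulAction.stabilizer G y = ⊥})
    (hαx : ¬ Representation.IsTrivial (α.comp (MulAction.stabilizer G x).subtype)) :
    ¬ CompactAction.IsTame X α := by
  intro htame
  obtain ⟨⟨g, hg⟩, v, hu⟩ : ∃ (g : MulAction.stabilizer G x) (v : V), α g v ≠ v := by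
    by_contra! h
    exact hαx ⟨fun g => LinearMap.ext fun v => h g v⟩
  obtain ⟨n, m, hm⟩ := CompactAction.IsTame.exists_generators htame
  obtain ⟨K, hK⟩ := CompactAction.exists_one_le_mul_sum_increments hα m hm g hu
  have hclosed : IsClosed {y : X | 1 ≤
      K * ∑ i, ‖m i (g⁻¹ • y) - m i y‖} :=
    isClosed_le (by fun_prop) (by fun_prop)
  have hxx : 1 ≤ K * ∑ i, ‖m i (g⁻¹ • x) - m i x‖ :=
    closure_minimal hK hclosed hx
  have hgx : g⁻¹ • x = x := by
    rw [inv_smul_eq_iff]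
    exact (MulAction.mem_stabilizer_iff.1 hg).symm
  simp only [hgx, sub_self, norm_zero, Finset.sum_const_zero, mul_zero] at hxx
  exact absurd hxx (by norm_num)
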